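/- Let $n\in\mathbb N$ and $0<\alpha<n$. For $f\in L^1_{\rm loc}(\mathbb R^n)$ let $$M_\alpha f(x)=\sup_{B\ni x}|B|^{-1+\frac{\alpha}{n}}\int_B|f(y)|\,dy ,$$ where the supremum is over all open balls $B\subset\mathbb R^n$ containing $x$. A Young function is a convex, left-continuous function $\Phi:[0,\infty)\to[0,\infty]$ with $\lim_{r\to0+}\Phi(r)=\Phi(0)=0$ and $\lim_{r\to\infty}\Phi(r)=\infty$. Write $\Phi\in\mathcal Y$ if moreover $0<\Phi(r)<\infty$ for all $0<r<\infty$, and $\Phi\in\nabla_2$ if there is $C>1$ with $\Phi(r)\le\frac1{2C}\Phi(Cr)$ for all $r\ge0$. Put $\Phi^{-1}(s)=\inf\{r\ge0:\Phi(r)>s\}$ and $$\|f\|_{L^\Phi}=\inf\Big\{\lambda>0:\int_{\mathbb R^n}\Phi\Big(\frac{|f(x)|}{\lambda}\Big)dx\le1\Big\},\qquad \|f\|_{WL^\Phi}=\inf\Big\{\lambda>0:\ \sup_{t>0}\Phi(t)\,\Big|\Big\{x\in\mathbb R^n:\frac{|f(x)|}{\lambda}>t\Big\}\Big|\le1\Big\},$$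 with the convention $0\cdot\infty=0$. The Orlicz space $L^\Phi(\mathbb R^n)$ consists of the $f\in L^1_{\rm loc}(\mathbb R^n)$ with $\int_{\mathbb R^n}\Phi(k|f(x)|)\,dx<\infty$ for some $k>0$, and the weak Orlicz space $WL^\Phi(\mathbb R^n)$ of the $f\in L^1_{\rm loc}(\mathbb R^n)$ with $\|f\|_{WL^\Phi}<\infty$. We say that $M_\alpha$ is bounded from $L^\Phi(\mathbb R^n)$ to $X$, where $X=L^\Psi(\mathbb R^n)$ or $X=WL^\Psi(\mathbb R^n)$, if there is a constant $C<\infty$ such that $M_\alpha f\in X$ and $\|M_\alpha f\|_X\le C\|f\|_{L^\Phi}$ for all $f\in L^\Phi(\mathbb R^n)$. Theorem. Let $\Phi,\Psi$ be Young functions and $\Phi\in\mathcal Y$. The condition $$\text{there is } C>0 \text{ such that } r^{-\frac{\alpha}{n}}\Phi^{-1}(r)\le C\,\Psi^{-1}(r)\quad\text{for all } r>0 \qquad(*)$$ is necessary and sufficient for the boundedness of $M_\alpha$ from $L^\Phi(\mathbb R^n)$ to $WL^\Psi(\mathbb R^n)$. Moreover, if $\Phi\in\nabla_2$, then $(*)$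 is necessary and sufficient for the boundedness of $M_\alpha$ from $L^\Phi(\mathbb R^n)$ to $L^\Psi(\mathbb R^n)$. -/

import Mathlib

open MeasureTheory Filter Set Topology
open scoped NNReal ENNReal

noncomputable section

/-- The Euclidean space `ℝⁿ`, with Lebesgue measure `volume`. -/
abbrev Rn (n : ℕ) : Type := EuclideanSpace ℝ (Fin n)

/-- Young functions `Φ : [0,∞) → [0,∞]`: convex, left-continuous,
`lim_{r → 0+} Φ(r) = Φ(0) = 0` and `lim_{r → ∞} Φ(r) = ∞`. -/
structure IsYoung (Φ : ℝ≥0 → ℝ≥0∞) : Prop where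
  convex : ConvexOn ℝ≥0 Set.univ Φ
  leftContinuous : ∀ r : ℝ≥0, ContinuousWithinAt Φ (Set.Iic r) r
  map_zero : Φ 0 = 0
  tendsto_zero : Tendsto Φ (𝓝[>] 0) (𝓝 0)
  tendsto_top : Tendsto Φ atTop (𝓝 ∞)

/-- The class `𝒴` of Young functions with `0 < Φ(r) < ∞` for all `0 < r < ∞`. -/
def IsClassY (Φ : ℝ≥0 → ℝ≥0∞) : Prop :=
  IsYoung Φ ∧ ∀ r : ℝ≥0, 0 < r → 0 < Φ r ∧ Φ r < ∞

/-- The `∇₂` condition: `Φ(r) ≤ (2C)⁻¹ Φ(C r)` for all `r ≥ 0`, for some `C > 1`. -/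
def Nabla2 (Φ : ℝ≥0 → ℝ≥0∞) : Prop :=
  ∃ C : ℝ≥0, 1 < C ∧ ∀ r : ℝ≥0, Φ r ≤ (2 * (C : ℝ≥0∞))⁻¹ * Φ (C * r)

/-- The generalized inverse `Φ⁻¹(s) = inf {r ≥ 0 : Φ(r) > s}` (with `inf ∅ = ∞`). -/
def youngInv (Φ : ℝ≥0 → ℝ≥0∞) (s : ℝ≥0∞) : ℝ≥0∞ :=
  ⨅ (r : ℝ≥0) (_ : s < Φ r), (r : ℝ≥0∞)

/-- `Φ` extended by `Φ(∞) = ∞`, so that it can be composed with functions that may take the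
value `∞` (on a null set, if they are locally integrable). -/
def youngExt (Φ : ℝ≥0 → ℝ≥0∞) (t : ℝ≥0∞) : ℝ≥0∞ :=
  if t = ∞ then ∞ else Φ t.toNNReal

/-- The fractional maximal function
`M_α f(x) = sup_{B ∋ x} |B|^{-1 + α/n} ∫_B |f(y)| dy`, over all balls `B` containing `x`. -/
def fracMaximal {n : ℕ} (α : ℝ) (f : Rn n → ℝ) (x : Rn n) : ℝ≥0∞ :=
  ⨆ (c : Rn n) (r : ℝ) (_ : x ∈ Metric.ball c r),
    volume (Metric.ball c r) ^ (-1 + α / (n : ℝ)) * (∫⁻ y in Metric.ball c r, ‖f y‖ₑ)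

section Orlicz

/- The values lie in `ε = ℝ`, with `‖f x‖ₑ = |f x|`, or in `ε = [0,∞]`, with `‖f x‖ₑ = f x`. -/
variable {n : ℕ} {ε : Type*} [TopologicalSpace ε] [ContinuousENorm ε]

/-- `f ∈ L^Φ(ℝⁿ)`: `f ∈ L¹_loc` and `∫ Φ(k |f(x)|) dx < ∞` for some `k > 0`. -/
def MemOrlicz (Φ : ℝ≥0 → ℝ≥0∞) (f : Rn n → ε) : Prop :=
  LocallyIntegrable f volume ∧
    ∃ k : ℝ≥0, 0 < k ∧ (∫⁻ x, youngExt Φ ((k : ℝ≥0∞) * ‖f x‖ₑ)) < ∞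

/-- `‖f‖_{L^Φ} = inf {λ > 0 : ∫ Φ(|f(x)| / λ) dx ≤ 1}`. -/
def orliczNorm (Φ : ℝ≥0 → ℝ≥0∞) (f : Rn n → ε) : ℝ≥0∞ :=
  ⨅ (l : ℝ≥0) (_ : 0 < l ∧ (∫⁻ x, youngExt Φ (‖f x‖ₑ / (l : ℝ≥0∞))) ≤ 1), (l : ℝ≥0∞)

/-- `‖f‖_{WL^Φ} = inf {λ > 0 : sup_{t > 0} Φ(t) |{x : |f(x)| / λ > t}| ≤ 1}`. -/
def weakOrliczNorm (Φ : ℝ≥0 → ℝ≥0∞) (f : Rn n → ε) : ℝ≥0∞ :=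
  ⨅ (l : ℝ≥0) (_ : 0 < l ∧
    (⨆ (t : ℝ≥0) (_ : 0 < t),
      Φ t * volume {x : Rn n | (t : ℝ≥0∞) < ‖f x‖ₑ / (l : ℝ≥0∞)}) ≤ 1), (l : ℝ≥0∞)

/-- `f ∈ WL^Φ(ℝⁿ)`: `f ∈ L¹_loc` and `‖f‖_{WL^Φ} < ∞`. -/
def MemWeakOrlicz (Φ : ℝ≥0 → ℝ≥0∞) (f : Rn n → ε) : Prop :=
  LocallyIntegrable f volume ∧ weakOrliczNorm Φ f < ∞

end Orlicz

/-- `M_α` is bounded from `L^Φ(ℝⁿ)` to `L^Ψ(ℝⁿ)`. -/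
def FracMaximalBounded (n : ℕ) (α : ℝ) (Φ Ψ : ℝ≥0 → ℝ≥0∞) : Prop :=
  ∃ C : ℝ≥0, ∀ f : Rn n → ℝ, MemOrlicz Φ f →
    MemOrlicz Ψ (fracMaximal α f) ∧
      orliczNorm Ψ (fracMaximal α f) ≤ C * orliczNorm Φ f

/-- `M_α` is bounded from `L^Φ(ℝⁿ)` to `WL^Ψ(ℝⁿ)`. -/
def FracMaximalWeakBounded (n : ℕ) (α : ℝ) (Φ Ψ : ℝ≥0 → ℝ≥0∞) : Prop :=
  ∃ C : ℝ≥0, ∀ f : Rn n → ℝ, MemOrlicz Φ f →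
    MemWeakOrlicz Ψ (fracMaximal α f) ∧
      weakOrliczNorm Ψ (fracMaximal α f) ≤ C * orliczNorm Φ f

/-- There is `C > 0` with `r^{-α/n} Φ⁻¹(r) ≤ C Ψ⁻¹(r)` for all `0 < r < ∞`. -/
def InverseCondition (n : ℕ) (α : ℝ) (Φ Ψ : ℝ≥0 → ℝ≥0∞) : Prop :=
  ∃ C : ℝ≥0, 0 < C ∧ ∀ r : ℝ≥0, 0 < r →
    (r : ℝ≥0∞) ^ (-(α / (n : ℝ))) * youngInv Φ r ≤ C * youngInv Ψ r

end

/-! ### Young functions -/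

namespace IsYoung

variable {Φ : ℝ≥0 → ℝ≥0∞}

/-! Sufficiency rests on a pointwise comparison that removes the fractional exponent. Normalise `F =
|f|/l` so that `∫ Φ(F) ≤ 1`, and for a ball `B` write `∫_B F = 2b|B|`. A weak Jensen inequality
gives `Φ(b)|B| ≤ ∫_B Φ(F) ≤ 1`, hence `|B|^{α/n} b ≤ Φ(b)^{-α/n} Φ⁻¹(Φ(b)) ≤ C Ψ⁻¹(Φ(b))`. So `t <
M_α F(x)/(2C)` forces `Ψ(t) ≤ Φ(b)` for some ball containing `x`
(`InverseCondition.exists_ball_of_lt`), and only ordinary averages remain.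

The Vitali weak (1,1) estimate `mul_volume_averageSuperlevel_le` then finishes both cases. For the
weak type it is applied to `Φ(F)`. For the strong type it is applied to the truncations of `F` at
heights `D^k`; `∇₂` makes the resulting sum over `k` geometric (`IsYoung.tsum_le_of_nabla2`).
Constants are absorbed by convexity. Membership in the target also requires local integrability of
`M_α f`, proved separately in `setLIntegral_lfracMaximal_ne_top`.

For necessity, strong boundedness implies weak boundedness by Chebyshev, and the weak bound is
tested on the indicator of a ball of volume `1/r`. -/

theorem map_mul_le (h : IsYoung Φ) {c : ℝ≥0} (hc : c ≤ 1) (t : ℝ≥0) : Φ (c * t) ≤ c * Φ t := by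
  have := h.convex.2 (mem_univ t) (mem_univ 0) zero_le zero_le
    (add_tsub_cancel_of_le hc)
  simpa [h.map_zero, ENNReal.smul_def] using this

theorem monotone (h : IsYoung Φ) : Monotone Φ := by
  intro s t hst
  rcases eq_or_ne t 0 with rfl | ht
  · rw [nonpos_iff_eq_zero.1 hst]
  have h1 : s / t ≤ 1 := div_le_one_of_le₀ hst (zero_le)
  calc Φ s = Φ (s / t * t) := by rw [div_mul_cancel₀ _ ht]
    _ ≤ (s / t : ℝ≥0) * Φ t := h.map_mul_le h1 t
    _ ≤ 1 * Φ t := by gcongr; exact_mod_cast h1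
    _ = Φ t := one_mul _

theorem youngExt_mono (h : IsYoung Φ) : Monotone (youngExt Φ) := by
  intro u v huv
  unfold youngExt
  split_ifs with hu hv hv
  · exact le_rfl
  · exact absurd (top_le_iff.1 (hu ▸ huv)) hv
  · exact le_top
  · exact h.monotone (ENNReal.toNNReal_mono hv huv)

theorem youngExt_mul_le (h : IsYoung Φ) {c : ℝ≥0} (hc : c ≤ 1) (u : ℝ≥0∞) :
    youngExt Φ (c * u) ≤ c * youngExt Φ u := by
  rcases eq_or_ne c 0 with rfl | hc0
  · simp [youngExt, h.map_zero]
  rcases eq_or_ne u ∞ with rfl | hu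
  · simp [youngExt, ENNReal.mul_top, hc0]
  · lift u to ℝ≥0 using hu
    rw [← ENNReal.coe_mul]
    simp only [youngExt, ENNReal.coe_ne_top, if_false, ENNReal.toNNReal_coe]
    exact h.map_mul_le hc u

/-- Left continuity settles finite `u`; growth at infinity settles `u = ∞`. -/
theorem youngExt_le_of_forall_lt (h : IsYoung Φ) {u S : ℝ≥0∞}
    (hu : ∀ t : ℝ≥0, (t : ℝ≥0∞) < u → Φ t ≤ S) : youngExt Φ u ≤ S := by
  rcases eq_or_ne u ∞ with rfl | hu'
  · simp only [youngExt, if_true]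
    exact le_of_tendsto h.tendsto_top (Eventually.of_forall fun t => hu t ENNReal.coe_lt_top)
  · lift u to ℝ≥0 using hu'
    simp only [youngExt, ENNReal.coe_ne_top, if_false, ENNReal.toNNReal_coe]
    rcases eq_or_ne u 0 with rfl | h0
    · simp [h.map_zero]
    have hne : (𝓝[<] u).NeBot := nhdsLT_neBot_of_exists_lt ⟨0, pos_iff_ne_zero.2 h0⟩
    refine le_of_tendsto ((h.leftContinuous u).mono_left (nhdsWithin_mono _ Iio_subset_Iic_self)) ?_
    filter_upwards [self_mem_nhdsWithin] with t ht
    exact hu t (by exact_mod_cast ht)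

/-- For `u ≤ b` monotonicity suffices; for `u ≥ b` the ratio `Φ(u)/u` is at least `Φ(b)/b` by
convexity. Integrating this replaces Jensen at the cost of a factor 2, with no measurability
assumption. -/
theorem mul_le_mul_add (h : IsYoung Φ) {b : ℝ≥0} (hb : b ≠ 0) (u : ℝ≥0∞) :
    Φ b * u ≤ b * (Φ b + youngExt Φ u) := by
  rcases eq_or_ne u ∞ with rfl | hu
  · simp [youngExt, ENNReal.mul_top, hb]
  lift u to ℝ≥0 using hu
  simp only [youngExt, ENNReal.coe_ne_top, if_false, ENNReal.toNNReal_coe]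
  rcases le_total u b with hub | hbu
  · calc Φ b * u ≤ Φ b * b := by gcongr
      _ = b * Φ b := mul_comm _ _
      _ ≤ _ := by gcongr; exact le_self_add
  · have hu0 : u ≠ 0 := (lt_of_lt_of_le (pos_iff_ne_zero.2 hb) hbu).ne'
    have h1 : b / u ≤ 1 := div_le_one_of_le₀ hbu (zero_le)
    have h2 : Φ b ≤ (b / u : ℝ≥0) * Φ u := by
      simpa [div_mul_cancel₀ _ hu0] using h.map_mul_le h1 u
    calc Φ b * u ≤ ((b / u : ℝ≥0) * Φ u) * u := by gcongr
      _ = ((b / u * u : ℝ≥0) : ℝ≥0∞) * Φ u := by push_cast; ring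
      _ = b * Φ u := by rw [div_mul_cancel₀ _ hu0]
      _ ≤ _ := by gcongr; exact le_add_self

theorem youngInv_ne_top (h : IsYoung Φ) (s : ℝ≥0) : youngInv Φ s ≠ ∞ := by
  obtain ⟨r, hr⟩ := (h.tendsto_top.eventually (lt_mem_nhds (ENNReal.coe_lt_top (r := s)))).exists
  exact ne_top_of_le_ne_top ENNReal.coe_ne_top (iInf₂_le r hr)

/-- A weak form of Jensen's inequality. -/
theorem mul_measure_le_lintegral (h : IsYoung Φ) {X : Type*} [MeasurableSpace X] {μ : Measure X}
    [IsFiniteMeasure μ] {F : X → ℝ≥0∞} {b : ℝ≥0} (hb : Φ b ≠ ∞)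
    (hF : 2 * b * μ univ ≤ ∫⁻ x, F x ∂μ) : Φ b * μ univ ≤ ∫⁻ x, youngExt Φ (F x) ∂μ := by
  rcases eq_or_ne b 0 with rfl | hb0
  · simp [h.map_zero]
  have hfin : (b : ℝ≥0∞) * (Φ b * μ univ) ≠ ∞ :=
    ENNReal.mul_ne_top ENNReal.coe_ne_top (ENNReal.mul_ne_top hb (measure_ne_top _ _))
  have key : b * (Φ b * μ univ) + b * (Φ b * μ univ)
      ≤ b * (Φ b * μ univ) + b * ∫⁻ x, youngExt Φ (F x) ∂μ :=
    calc b * (Φ b * μ univ) + b * (Φ b * μ univ) = Φ b * (2 * b * μ univ) := by ring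
      _ ≤ Φ b * ∫⁻ x, F x ∂μ := by gcongr
      _ = ∫⁻ x, Φ b * F x ∂μ := (lintegral_const_mul' _ _ hb).symm
      _ ≤ ∫⁻ x, b * (Φ b + youngExt Φ (F x)) ∂μ := lintegral_mono fun x => h.mul_le_mul_add hb0 _
      _ = b * (Φ b * μ univ + ∫⁻ x, youngExt Φ (F x) ∂μ) := by
        rw [lintegral_const_mul' _ _ ENNReal.coe_ne_top, lintegral_add_left measurable_const,
          lintegral_const]
      _ = _ := by ring
  have := (ENNReal.add_le_add_iff_left hfin).1 key
  exact (ENNReal.mul_le_mul_iff_right (by simpa using hb0) ENNReal.coe_ne_top).1 this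

end IsYoung

theorem le_youngInv_self {Φ : ℝ≥0 → ℝ≥0∞} (h : IsYoung Φ) (b : ℝ≥0) :
    (b : ℝ≥0∞) ≤ youngInv Φ (Φ b) :=
  le_iInf₂ fun r hr => by
    have : b < r := h.monotone.reflect_lt hr
    exact_mod_cast this.le

theorem le_of_lt_youngInv {Φ : ℝ≥0 → ℝ≥0∞} {t : ℝ≥0} {s : ℝ≥0∞} (h : (t : ℝ≥0∞) < youngInv Φ s) :
    Φ t ≤ s :=
  not_lt.1 fun hs => (h.trans_le (iInf₂_le (f := fun (r : ℝ≥0) (_ : s < Φ r) => (r : ℝ≥0∞)) t hs)).false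

theorem youngInv_mono (Φ : ℝ≥0 → ℝ≥0∞) : Monotone (youngInv Φ) := fun _ _ hst =>
  le_iInf₂ fun r hr => iInf₂_le r (hst.trans_lt hr)

/-- The key estimate: fractional averages over balls are controlled through `Ψ⁻¹`. -/
theorem InverseCondition.average_le {n : ℕ} {α : ℝ} (hα : 0 ≤ α)
    {Φ Ψ : ℝ≥0 → ℝ≥0∞} (hΦ : IsClassY Φ) {C : ℝ≥0}
    (hC : ∀ r : ℝ≥0, 0 < r →
      (r : ℝ≥0∞) ^ (-(α / (n : ℝ))) * youngInv Φ r ≤ C * youngInv Ψ r)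
    {V I : ℝ≥0∞} {b : ℝ≥0} (hV0 : V ≠ 0) (hV : V ≠ ∞) (hI : I = 2 * b * V) (hb : Φ b * V ≤ 1) :
    V ^ (-1 + α / (n : ℝ)) * I ≤ 2 * C * youngInv Ψ (Φ b) := by
  rcases eq_or_ne b 0 with rfl | hb0
  · simp [hI]
  obtain ⟨hp, hlt⟩ := hΦ.2 b (pos_iff_ne_zero.2 hb0)
  have hs : 0 ≤ α / (n : ℝ) := by positivity
  have h1 : V ≤ (Φ b)⁻¹ := by
    rw [ENNReal.le_inv_iff_mul_le, mul_comm]; exact hb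
  have h2 : V ^ (α / (n : ℝ)) ≤ Φ b ^ (-(α / (n : ℝ))) := by
    rw [ENNReal.rpow_neg, ← ENNReal.inv_rpow]
    exact ENNReal.rpow_le_rpow h1 hs
  have h3 := hC (Φ b).toNNReal (ENNReal.toNNReal_pos hp.ne' hlt.ne)
  rw [ENNReal.coe_toNNReal hlt.ne] at h3
  calc V ^ (-1 + α / (n : ℝ)) * I = 2 * (V ^ (α / (n : ℝ)) * b) := by
        rw [hI, ENNReal.rpow_add _ _ hV0 hV, ENNReal.rpow_neg_one]
        calc V⁻¹ * V ^ (α / (n : ℝ)) * (2 * b * V)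
            = (V⁻¹ * V) * (2 * (V ^ (α / (n : ℝ)) * b)) := by ring
          _ = _ := by rw [ENNReal.inv_mul_cancel hV0 hV, one_mul]
    _ ≤ 2 * (Φ b ^ (-(α / (n : ℝ))) * youngInv Φ (Φ b)) := by
        gcongr
        exact le_youngInv_self hΦ.1 b
    _ ≤ 2 * (C * youngInv Ψ (Φ b)) := by gcongr
    _ = _ := by ring

/-! ### The weak type estimate for averages over balls -/

/-- The union of the balls over which the average of `G` is at least `τ`. -/
def averageSuperlevel {n : ℕ} (G : Rn n → ℝ≥0∞) (τ : ℝ≥0∞) : Set (Rn n) :=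
  {x | ∃ (c : Rn n) (r : ℝ), x ∈ Metric.ball c r ∧
    τ * volume (Metric.ball c r) ≤ ∫⁻ y in Metric.ball c r, G y}

theorem isOpen_averageSuperlevel {n : ℕ} (G : Rn n → ℝ≥0∞) (τ : ℝ≥0∞) :
    IsOpen (averageSuperlevel G τ) := by
  refine isOpen_iff_mem_nhds.2 ?_
  rintro x ⟨c, r, hx, h⟩
  filter_upwards [Metric.isOpen_ball.mem_nhds hx] with y hy
  exact ⟨c, r, hy, h⟩

/-- A radius `r > 1` satisfies `r ≤ r ^ n`. The bound feeds the Vitali covering lemma and later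
confines small balls to a fixed one. -/
theorem exists_radius_le_of_volume_ball_le {n : ℕ} (hn : n ≠ 0) {K : ℝ≥0∞} (hK : K ≠ ∞) :
    ∃ R : ℝ, 0 ≤ R ∧ ∀ (c : Rn n) (r : ℝ), volume (Metric.ball c r) ≤ K → r ≤ R := by
  set V := volume (Metric.ball (0 : Rn n) 1)
  have hV0 : V ≠ 0 := (Metric.measure_ball_pos volume _ one_pos).ne'
  have hV : V ≠ ∞ := measure_ball_lt_top.ne
  refine ⟨1 + (K / V).toReal, by positivity, fun c r h => ?_⟩
  rcases le_or_gt r 1 with hr | hr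
  · linarith [(K / V).toReal_nonneg]
  have hr0 : 0 < r := by linarith
  rw [Measure.addHaar_ball_of_pos volume c hr0, finrank_euclideanSpace_fin] at h
  have h1 : ENNReal.ofReal (r ^ n) ≤ K / V :=
    (ENNReal.le_div_iff_mul_le (Or.inl hV0) (Or.inl hV)).2 h
  have h2 : r ^ n ≤ (K / V).toReal :=
    (ENNReal.ofReal_le_iff_le_toReal (ENNReal.div_ne_top hK hV0)).1 h1
  linarith [le_self_pow₀ hr.le hn]

/-- The averages over balls satisfy a weak type `(1,1)` estimate. -/
theorem mul_volume_averageSuperlevel_le {n : ℕ} (hn : n ≠ 0) (G : Rn n → ℝ≥0∞) (τ : ℝ≥0∞) :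
    τ * volume (averageSuperlevel G τ) ≤ 5 ^ n * ∫⁻ y, G y := by
  rcases eq_or_ne τ 0 with rfl | hτ
  · simp
  rcases eq_or_ne (∫⁻ y, G y) ∞ with hG | hG
  · simp [hG, ENNReal.mul_top]
  -- Every ball in the family has volume at most `(∫ G)/τ`, which gives the uniform radius bound
  -- Vitali requires.
  obtain ⟨R, -, hR⟩ := exists_radius_le_of_volume_ball_le hn (ENNReal.div_ne_top hG hτ)
  let t : Set (Rn n × ℝ) := {p | 0 < p.2 ∧
    τ * volume (Metric.ball p.1 p.2) ≤ ∫⁻ y in Metric.ball p.1 p.2, G y}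
  have htR : ∀ p ∈ t, p.2 ≤ R := fun p hp => hR p.1 p.2 <| by
    rw [ENNReal.le_div_iff_mul_le (Or.inl hτ) (Or.inr hG), mul_comm]
    exact hp.2.trans (setLIntegral_le_lintegral _ _)
  obtain ⟨u, hut, hdisj, hcov⟩ := Vitali.exists_disjoint_subfamily_covering_enlargement_closedBall
    t (fun p => p.1) (fun p => p.2) R htR 5 (by norm_num)
  have hcount : u.Countable := hdisj.countable_of_nonempty_interior fun p hp => by
    refine ⟨p.1, Metric.ball_subset_interior_closedBall ?_⟩
    exact Metric.mem_ball_self (hut hp).1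
  have hsub : averageSuperlevel G τ ⊆ ⋃ p ∈ u, Metric.closedBall p.1 (5 * p.2) := by
    rintro x ⟨c, r, hx, h⟩
    obtain ⟨p, hp, hsub⟩ := hcov (c, r) ⟨Metric.pos_of_mem_ball hx, h⟩
    exact mem_biUnion hp (hsub (Metric.ball_subset_closedBall hx))
  have hvol : ∀ p ∈ t, volume (Metric.closedBall p.1 (5 * p.2))
      = 5 ^ n * volume (Metric.ball p.1 p.2) := fun p hp => by
    rw [Measure.addHaar_closedBall _ _ (by linarith [hp.1] : (0 : ℝ) ≤ 5 * p.2),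
      Measure.addHaar_ball_of_pos volume p.1 hp.1, finrank_euclideanSpace_fin, mul_pow,
      ENNReal.ofReal_mul (by positivity), ENNReal.ofReal_pow (by norm_num), mul_assoc]
    norm_num
  have : Countable u := hcount.to_subtype
  calc τ * volume (averageSuperlevel G τ)
      ≤ τ * ∑' p : u, volume (Metric.closedBall p.1.1 (5 * p.1.2)) := by
        gcongr
        exact (measure_mono hsub).trans (measure_biUnion_le _ hcount _)
    _ = ∑' p : u, 5 ^ n * (τ * volume (Metric.ball p.1.1 p.1.2)) := by
        rw [← ENNReal.tsum_mul_left]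
        congr 1 with p
        rw [hvol p.1 (hut p.2)]; ring
    _ ≤ ∑' p : u, 5 ^ n * ∫⁻ y in Metric.closedBall p.1.1 p.1.2, G y := by
        gcongr with p
        exact (hut p.2).2.trans (lintegral_mono_set Metric.ball_subset_closedBall)
    _ = 5 ^ n * ∫⁻ y in ⋃ p ∈ u, Metric.closedBall p.1 p.2, G y := by
        rw [ENNReal.tsum_mul_left, lintegral_biUnion hcount
          (fun p _ => Metric.isClosed_closedBall.measurableSet) hdisj]
    _ ≤ 5 ^ n * ∫⁻ y, G y := by
        gcongr
        exact Measure.restrict_le_self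

/-! ### Pointwise control of the fractional maximal function -/

/-- The fractional maximal function of a function with values in `[0,∞]`. -/
noncomputable def lfracMaximal {n : ℕ} (α : ℝ) (F : Rn n → ℝ≥0∞) (x : Rn n) : ℝ≥0∞ :=
  ⨆ (c : Rn n) (r : ℝ) (_ : x ∈ Metric.ball c r),
    volume (Metric.ball c r) ^ (-1 + α / (n : ℝ)) * (∫⁻ y in Metric.ball c r, F y)

theorem fracMaximal_div {n : ℕ} (α : ℝ) (f : Rn n → ℝ) {l : ℝ≥0} (hl : l ≠ 0) (x : Rn n) :
    fracMaximal α f x / l = lfracMaximal α (fun y => ‖f y‖ₑ / l) x := by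
  have hl' : (l : ℝ≥0∞)⁻¹ ≠ ∞ := ENNReal.inv_ne_top.2 (by exact_mod_cast hl)
  simp only [fracMaximal, lfracMaximal, ENNReal.iSup_mul, div_eq_mul_inv _ (l : ℝ≥0∞),
    lintegral_mul_const' _ _ hl', mul_assoc]

/-- Balls are open and uncentred, so a ball that witnesses a large value at `x` does so at all
nearby points. -/
theorem measurable_lfracMaximal {n : ℕ} (α : ℝ) (F : Rn n → ℝ≥0∞) :
    Measurable (lfracMaximal α F) := by
  refine measurable_of_Ioi fun t => IsOpen.measurableSet (isOpen_iff_mem_nhds.2 fun x hx => ?_)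
  simp only [mem_preimage, mem_Ioi, lfracMaximal, lt_iSup_iff] at hx
  obtain ⟨c, r, hxB, h⟩ := hx
  filter_upwards [Metric.isOpen_ball.mem_nhds hxB] with y hy
  simp only [mem_preimage, mem_Ioi, lfracMaximal, lt_iSup_iff]
  exact ⟨c, r, hy, h⟩

section

variable {n : ℕ} {α : ℝ} {Φ Ψ : ℝ≥0 → ℝ≥0∞} {C : ℝ≥0} {F : Rn n → ℝ≥0∞}

/-- Here `b` is half the average of `F`, to match the factor 2 lost in the weak Jensen inequality.
-/
theorem IsClassY.exists_average (hΦ : IsClassY Φ) (hball : ∀ c r, ∫⁻ y in Metric.ball c r, F y ≠ ∞)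
    (c : Rn n) {r : ℝ} (hr : 0 < r) :
    ∃ b : ℝ≥0, ∫⁻ y in Metric.ball c r, F y = 2 * b * volume (Metric.ball c r) ∧
      Φ b * volume (Metric.ball c r) ≤ ∫⁻ y in Metric.ball c r, youngExt Φ (F y) := by
  have hV0 : volume (Metric.ball c r) ≠ 0 := (Metric.measure_ball_pos volume _ hr).ne'
  have hV : volume (Metric.ball c r) ≠ ∞ := measure_ball_lt_top.ne
  set a := (∫⁻ y in Metric.ball c r, F y) / (2 * volume (Metric.ball c r)) with ha
  have hV2 : 2 * volume (Metric.ball c r) ≠ 0 := mul_ne_zero two_ne_zero hV0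
  have hV2' : 2 * volume (Metric.ball c r) ≠ ∞ := ENNReal.mul_ne_top ENNReal.ofNat_ne_top hV
  have ha' : a ≠ ∞ := ENNReal.div_ne_top (hball c r) hV2
  have hI : ∫⁻ y in Metric.ball c r, F y = 2 * a.toNNReal * volume (Metric.ball c r) := by
    rw [ENNReal.coe_toNNReal ha', mul_right_comm, ha, ENNReal.mul_div_cancel hV2 hV2']
  refine ⟨a.toNNReal, hI, ?_⟩
  have : IsFiniteMeasure (volume.restrict (Metric.ball c r)) := ⟨by simpa using hV.lt_top⟩
  have hfin : Φ a.toNNReal ≠ ∞ := by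
    rcases eq_or_ne a.toNNReal 0 with h0 | h0
    · simp [h0, hΦ.1.map_zero]
    · exact (hΦ.2 _ (pos_iff_ne_zero.2 h0)).2.ne
  have := hΦ.1.mul_measure_le_lintegral (μ := volume.restrict (Metric.ball c r)) (F := F) hfin
    (by rw [hI, Measure.restrict_apply_univ])
  rwa [Measure.restrict_apply_univ] at this

theorem InverseCondition.exists_ball_of_lt (hα : 0 ≤ α) (hΦ : IsClassY Φ)
    (hC : ∀ r : ℝ≥0, 0 < r → (r : ℝ≥0∞) ^ (-(α / (n : ℝ))) * youngInv Φ r ≤ C * youngInv Ψ r)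
    (hC0 : C ≠ 0) (hball : ∀ c r, ∫⁻ y in Metric.ball c r, F y ≠ ∞)
    (hF : ∫⁻ y, youngExt Φ (F y) ≤ 1) {x : Rn n} {t : ℝ≥0}
    (ht : (t : ℝ≥0∞) < lfracMaximal α F x / (2 * C : ℝ≥0)) :
    ∃ (c : Rn n) (r : ℝ) (b : ℝ≥0), x ∈ Metric.ball c r ∧
      ∫⁻ y in Metric.ball c r, F y = 2 * b * volume (Metric.ball c r) ∧
      Φ b * volume (Metric.ball c r) ≤ ∫⁻ y in Metric.ball c r, youngExt Φ (F y) ∧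
      Ψ t ≤ Φ b := by
  simp only [lfracMaximal, ENNReal.iSup_div, lt_iSup_iff] at ht
  obtain ⟨c, r, hx, ht⟩ := ht
  have hr := Metric.pos_of_mem_ball hx
  obtain ⟨b, hI, hb⟩ := hΦ.exists_average hball c hr
  refine ⟨c, r, b, hx, hI, hb, le_of_lt_youngInv ?_⟩
  have h2C : ((2 * C : ℝ≥0) : ℝ≥0∞) ≠ 0 := by simpa using hC0
  refine ht.trans_le (ENNReal.div_le_of_le_mul' ?_)
  have := InverseCondition.average_le hα hΦ hC (Metric.measure_ball_pos volume c hr).ne'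
    measure_ball_lt_top.ne hI ((hb.trans (setLIntegral_le_lintegral _ _)).trans hF)
  simpa using this

/-! ### Weak and strong modular estimates -/

theorem InverseCondition.weak_estimate (hn : n ≠ 0) (hα : 0 ≤ α) (hΦ : IsClassY Φ)
    (hC : ∀ r : ℝ≥0, 0 < r → (r : ℝ≥0∞) ^ (-(α / (n : ℝ))) * youngInv Φ r ≤ C * youngInv Ψ r)
    (hC0 : C ≠ 0) (hball : ∀ c r, ∫⁻ y in Metric.ball c r, F y ≠ ∞)
    (hF : ∫⁻ y, youngExt Φ (F y) ≤ 1) (t : ℝ≥0) :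
    Ψ t * volume {x | (t : ℝ≥0∞) < lfracMaximal α F x / (2 * C : ℝ≥0)} ≤ 5 ^ n :=
  calc Ψ t * volume {x | (t : ℝ≥0∞) < lfracMaximal α F x / (2 * C : ℝ≥0)}
      ≤ Ψ t * volume (averageSuperlevel (fun y => youngExt Φ (F y)) (Ψ t)) := by
        gcongr
        intro x hx
        -- Since `Ψ t ≤ Φ b`, the average of `Φ(F)` over this ball is at least `Ψ t`.
        obtain ⟨c, r, b, hxB, -, hb, hΨ⟩ := exists_ball_of_lt hα hΦ hC hC0 hball hF hx
        exact ⟨c, r, hxB, hb.trans' (by gcongr)⟩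
    _ ≤ 5 ^ n * ∫⁻ y, youngExt Φ (F y) := mul_volume_averageSuperlevel_le hn _ _
    _ ≤ 5 ^ n * 1 := by gcongr
    _ = 5 ^ n := mul_one _

/-- The dyadic sum that results from the distribution function, for `Φ ∈ ∇₂`. -/
theorem IsYoung.tsum_le_of_nabla2 (hΦ : IsYoung Φ) {D : ℝ≥0} (hD : 1 < D)
    (h : ∀ r : ℝ≥0, Φ r ≤ (2 * (D : ℝ≥0∞))⁻¹ * Φ (D * r)) (t : ℝ≥0) :
    ∑' k : ℤ, Φ (D ^ (k + 1)) * ((D ^ k)⁻¹ : ℝ≥0) *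
      (if ((D ^ k : ℝ≥0) : ℝ≥0∞) < t then (t : ℝ≥0∞) else 0) ≤ 2 * D * Φ (D * t) := by
  have hD0 : D ≠ 0 := (zero_lt_one.trans hD).ne'
  rcases eq_or_ne t 0 with rfl | ht
  · simp
  -- With `D^K < t ≤ D^(K+1)`, only the terms `k = K - j`, `j ≥ 0`, survive.
  obtain ⟨K, hK1, hK2⟩ := exists_mem_Ioc_zpow (pos_iff_ne_zero.2 ht) hD
  have hsupp : Function.support (fun k : ℤ => Φ (D ^ (k + 1)) * ((D ^ k)⁻¹ : ℝ≥0) *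
      (if ((D ^ k : ℝ≥0) : ℝ≥0∞) < t then (t : ℝ≥0∞) else 0)) ⊆ range fun j : ℕ => K - (j : ℤ) := by
    intro k hk
    have hkt : D ^ k < t := by
      by_contra hlt
      exact hk (by simp only [ENNReal.coe_lt_coe, if_neg hlt, mul_zero])
    have : k < K + 1 := (zpow_lt_zpow_iff_right₀ hD).1 (hkt.trans_le hK2)
    exact ⟨(K - k).toNat, by simp only; omega⟩
  have hinj : Function.Injective fun j : ℕ => K - (j : ℤ) := fun i j hij => by
    simp only at hij; omega
  rw [← hinj.tsum_eq hsupp]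
  -- By `∇₂`, lowering `k` by one at least halves `Φ(D^(k+1)) / D^k`.
  have hstep : ∀ j : ℕ, Φ (D ^ (K - (j : ℤ) + 1)) * ((D ^ (K - (j : ℤ)))⁻¹ : ℝ≥0) ≤
      2⁻¹ ^ j * (Φ (D ^ (K + 1)) * ((D ^ K)⁻¹ : ℝ≥0)) := by
    intro j
    induction j with
    | zero => simp
    | succ j ih =>
      have e1 : K - ((j + 1 : ℕ) : ℤ) + 1 = K - j := by push_cast; ring
      have e2 : (D ^ (K - ((j + 1 : ℕ) : ℤ)))⁻¹ = D * (D ^ (K - (j : ℤ)))⁻¹ := by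
        rw [← zpow_neg, ← zpow_neg, ← zpow_one_add₀ hD0]; congr 1; push_cast; ring
      have e3 : D * D ^ (K - (j : ℤ)) = D ^ (K - (j : ℤ) + 1) := by
        rw [← zpow_one_add₀ hD0, add_comm]
      have hD' : (D : ℝ≥0∞)⁻¹ * D = 1 :=
        ENNReal.inv_mul_cancel (by exact_mod_cast hD0) ENNReal.coe_ne_top
      rw [e1, e2]
      calc Φ (D ^ (K - (j : ℤ))) * ((D * (D ^ (K - (j : ℤ)))⁻¹ : ℝ≥0) : ℝ≥0∞)
          ≤ ((2 * (D : ℝ≥0∞))⁻¹ * Φ (D * D ^ (K - (j : ℤ)))) *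
            ((D * (D ^ (K - (j : ℤ)))⁻¹ : ℝ≥0) : ℝ≥0∞) := by gcongr; exact h _
        _ = 2⁻¹ * ((D : ℝ≥0∞)⁻¹ * D) *
            (Φ (D ^ (K - (j : ℤ) + 1)) * ((D ^ (K - (j : ℤ)))⁻¹ : ℝ≥0)) := by
          rw [e3, ENNReal.mul_inv (by simp) (by simp), ENNReal.coe_mul]; ring
        _ ≤ 2⁻¹ * (2⁻¹ ^ j * (Φ (D ^ (K + 1)) * ((D ^ K)⁻¹ : ℝ≥0))) := by
          rw [hD', mul_one]; gcongr
        _ = _ := by rw [pow_succ]; ring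
  have hDt : ((D ^ K)⁻¹ : ℝ≥0) * t ≤ D := by
    rw [inv_mul_le_iff₀ (zpow_pos (pos_iff_ne_zero.2 hD0) K)]
    rwa [zpow_add_one₀ hD0] at hK2
  have hΦK : Φ (D ^ (K + 1)) ≤ Φ (D * t) := hΦ.monotone <| by
    rw [zpow_add_one₀ hD0, mul_comm]; gcongr
  calc _ ≤ ∑' j : ℕ, 2⁻¹ ^ j * (Φ (D ^ (K + 1)) * ((D ^ K)⁻¹ : ℝ≥0)) * t := by
        refine ENNReal.tsum_le_tsum fun j => mul_le_mul' (hstep j) ?_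
        split_ifs
        · exact le_rfl
        · exact zero_le
    _ = 2 * (((D ^ K)⁻¹ * t : ℝ≥0) * Φ (D ^ (K + 1))) := by
        rw [ENNReal.tsum_mul_right, ENNReal.tsum_mul_right, ENNReal.tsum_geometric_two,
          ENNReal.coe_mul]
        ring
    _ ≤ 2 * (D * Φ (D * t)) := by gcongr
    _ = _ := by ring

theorem InverseCondition.strong_estimate (hn : n ≠ 0) (hα : 0 ≤ α) (hΦ : IsClassY Φ)
    (hΨ : IsYoung Ψ)
    (hC : ∀ r : ℝ≥0, 0 < r → (r : ℝ≥0∞) ^ (-(α / (n : ℝ))) * youngInv Φ r ≤ C * youngInv Ψ r)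
    (hC0 : C ≠ 0) (hmeas : AEMeasurable F) (hball : ∀ c r, ∫⁻ y in Metric.ball c r, F y ≠ ∞)
    (hF : ∫⁻ y, youngExt Φ (F y) ≤ 1) {D : ℝ≥0} (hD : 1 < D)
    (h : ∀ r : ℝ≥0, Φ r ≤ (2 * (D : ℝ≥0∞))⁻¹ * Φ (D * r)) :
    ∫⁻ x, youngExt Ψ (lfracMaximal α F x / (2 * C : ℝ≥0)) ≤
      5 ^ n * (2 * D) * ∫⁻ y, youngExt Φ (D * F y) := by
  have hD0 : D ≠ 0 := (zero_lt_one.trans hD).ne'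
  -- Truncating at `D^k` makes the weak (1,1) bound at height `D^k` see only the large values of
  -- `F`.
  let T : ℤ → Rn n → ℝ≥0∞ := fun k y => if ((D ^ k : ℝ≥0) : ℝ≥0∞) < F y then F y else 0
  let E : ℤ → Set (Rn n) := fun k => averageSuperlevel (T k) (D ^ k : ℝ≥0)
  have hT : ∀ k, AEMeasurable (T k) := fun k =>
    (Measurable.ite measurableSet_Ioi measurable_id measurable_const :
      Measurable fun u : ℝ≥0∞ => if ((D ^ k : ℝ≥0) : ℝ≥0∞) < u then u else 0).comp_aemeasurable hmeas
  have hpt : ∀ x, youngExt Ψ (lfracMaximal α F x / (2 * C : ℝ≥0)) ≤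
      ∑' k : ℤ, (E k).indicator (fun _ => Φ (D ^ (k + 1))) x := by
    intro x
    refine hΨ.youngExt_le_of_forall_lt fun t ht => ?_
    obtain ⟨c, r, b, hxB, hI, -, hΨb⟩ := exists_ball_of_lt hα hΦ hC hC0 hball hF ht
    refine hΨb.trans ?_
    rcases eq_or_ne b 0 with rfl | hb
    · simp [hΦ.1.map_zero]
    obtain ⟨k, hk1, hk2⟩ := exists_mem_Ioc_zpow (pos_iff_ne_zero.2 hb) hD
    have hxE : x ∈ E k := by
      refine ⟨c, r, hxB, ?_⟩
      have hfin : ((D ^ k : ℝ≥0) : ℝ≥0∞) * volume (Metric.ball c r) ≠ ∞ :=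
        ENNReal.mul_ne_top ENNReal.coe_ne_top measure_ball_lt_top.ne
      -- The average `2b` exceeds `2 D^k`, while values of `F` up to `D^k` contribute at most `D^k`;
      -- the truncation keeps an average of at least `D^k`.
      refine (ENNReal.add_le_add_iff_left hfin).1 ?_
      calc _ = 2 * ((D ^ k : ℝ≥0) : ℝ≥0∞) * volume (Metric.ball c r) := by ring
        _ ≤ 2 * b * volume (Metric.ball c r) := by gcongr
        _ = ∫⁻ y in Metric.ball c r, F y := hI.symm
        _ ≤ ∫⁻ y in Metric.ball c r, (((D ^ k : ℝ≥0) : ℝ≥0∞) + T k y) := by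
          refine lintegral_mono fun y => ?_
          simp only [T]
          split_ifs with hy
          · exact le_add_self
          · simpa using hy
        _ = _ := by rw [lintegral_add_left measurable_const, setLIntegral_const]
    calc Φ b ≤ Φ (D ^ (k + 1)) := hΦ.1.monotone hk2
      _ = (E k).indicator (fun _ => Φ (D ^ (k + 1))) x := by rw [indicator_of_mem hxE]
      _ ≤ _ := ENNReal.le_tsum k
  have hE : ∀ k, MeasurableSet (E k) := fun k => (isOpen_averageSuperlevel _ _).measurableSet
  calc ∫⁻ x, youngExt Ψ (lfracMaximal α F x / (2 * C : ℝ≥0))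
      ≤ ∫⁻ x, ∑' k : ℤ, (E k).indicator (fun _ => Φ (D ^ (k + 1))) x := lintegral_mono hpt
    _ = ∑' k : ℤ, Φ (D ^ (k + 1)) * volume (E k) := by
      rw [lintegral_tsum fun k => (measurable_const.indicator (hE k)).aemeasurable]
      simp only [lintegral_indicator_const (hE _)]
    _ ≤ ∑' k : ℤ, Φ (D ^ (k + 1)) * (((D ^ k)⁻¹ : ℝ≥0) * (5 ^ n * ∫⁻ y, T k y)) := by
      gcongr with k
      have hk : D ^ k ≠ 0 := zpow_ne_zero k hD0
      rw [ENNReal.coe_inv hk, ← ENNReal.mul_le_iff_le_inv (by exact_mod_cast hk) ENNReal.coe_ne_top]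
      exact mul_volume_averageSuperlevel_le hn _ _
    _ = 5 ^ n * ∑' k : ℤ, ∫⁻ y, Φ (D ^ (k + 1)) * ((D ^ k)⁻¹ : ℝ≥0) * T k y := by
      rw [← ENNReal.tsum_mul_left]
      congr 1 with k
      have : Φ (D ^ (k + 1)) ≠ ∞ := (hΦ.2 _ (zpow_pos (pos_iff_ne_zero.2 hD0) _)).2.ne
      rw [lintegral_const_mul' _ _ (ENNReal.mul_ne_top this ENNReal.coe_ne_top)]
      ring
    _ = 5 ^ n * ∫⁻ y, ∑' k : ℤ, Φ (D ^ (k + 1)) * ((D ^ k)⁻¹ : ℝ≥0) * T k y := by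
      rw [lintegral_tsum fun k => (hT k).const_mul _]
    _ ≤ 5 ^ n * ∫⁻ y, 2 * D * youngExt Φ (D * F y) := by
      gcongr with y
      rcases eq_or_ne (F y) ∞ with hy | hy
      · simp [hy, youngExt, ENNReal.mul_top, hD0]
      · have := hΦ.1.tsum_le_of_nabla2 hD h (F y).toNNReal
        rw [ENNReal.coe_toNNReal hy] at this
        rwa [youngExt, if_neg (ENNReal.mul_ne_top ENNReal.coe_ne_top hy), ENNReal.toNNReal_mul,
          ENNReal.toNNReal_coe]
    _ = _ := by
      rw [lintegral_const_mul' _ _ (ENNReal.mul_ne_top ENNReal.ofNat_ne_top ENNReal.coe_ne_top)]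
      ring

end

/-! ### Local integrability of the fractional maximal function -/

/-- For `a > 1` the single term with `2^k ≤ a < 2^(k+1)` suffices. As `p` need only be implied by
`2^k ≤ a`, it can be membership in a superlevel set. -/
theorem ENNReal.rpow_le_one_add_tsum {a : ℝ≥0∞} (ha : a ≠ ∞) {θ : ℝ} (hθ : 0 ≤ θ)
    (p : ℕ → Prop) [DecidablePred p] (hp : ∀ k, 2 ^ k ≤ a → p k) :
    a ^ θ ≤ 1 + ∑' k : ℕ, if p k then ((2 : ℝ≥0∞) ^ (k + 1)) ^ θ else 0 := by
  lift a to ℝ≥0 using ha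
  rcases le_or_gt a 1 with h1 | h1
  · refine le_add_right (ENNReal.rpow_le_one (by exact_mod_cast h1) hθ)
  · obtain ⟨k, hk1, hk2⟩ := exists_nat_pow_near h1.le (by norm_num : (1 : ℝ≥0) < 2)
    refine le_add_left (le_trans ?_ (ENNReal.le_tsum k))
    rw [if_pos (hp k (by exact_mod_cast hk1))]
    exact ENNReal.rpow_le_rpow (by exact_mod_cast hk2.le) hθ

theorem ENNReal.rpow_neg_one_add_mul_self {V I : ℝ≥0∞} {s : ℝ} (hs0 : 0 ≤ s) (hs1 : s ≤ 1) :
    V ^ (-1 + s) * I = (I / V) ^ (1 - s) * I ^ s := by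
  rw [ENNReal.div_rpow_of_nonneg _ _ (by linarith), div_eq_mul_inv, ← ENNReal.rpow_neg,
    mul_right_comm, ← ENNReal.rpow_add_of_nonneg _ _ (by linarith) hs0]
  simp [mul_comm]
  congr 2; ring

section

variable {n : ℕ} {α : ℝ} {Φ Ψ : ℝ≥0 → ℝ≥0∞} {C : ℝ≥0} {F : Rn n → ℝ≥0∞}

-- Balls with `|B| ≥ 1` contribute at most a constant, since then `Φ(b) ≤ 1`. Smaller balls lie in a
-- fixed ball of mass `N`, where the fractional average is at most `N^s` times the `(1-s)`-th power
-- of an ordinary average. That power is locally integrable by the weak (1,1) bound (Kolmogorov's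
-- argument), because `s > 0`.
open Classical in
theorem InverseCondition.setLIntegral_lfracMaximal_ne_top (hn : n ≠ 0) (hα : 0 < α)
    (hαn : α < n) (hΦ : IsClassY Φ) (hΨ : IsYoung Ψ)
    (hC : ∀ r : ℝ≥0, 0 < r → (r : ℝ≥0∞) ^ (-(α / (n : ℝ))) * youngInv Φ r ≤ C * youngInv Ψ r)
    (hball : ∀ c r, ∫⁻ y in Metric.ball c r, F y ≠ ∞)
    (hF : ∫⁻ y, youngExt Φ (F y) ≤ 1) (x₀ : Rn n) :
    ∫⁻ x in Metric.ball x₀ 1, lfracMaximal α F x ≠ ∞ := by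
  have hn0 : (0 : ℝ) < n := by positivity
  have hs0 : 0 < α / (n : ℝ) := by positivity
  have hs1 : α / (n : ℝ) < 1 := (div_lt_one hn0).2 hαn
  obtain ⟨R, hR0, hR⟩ := exists_radius_le_of_volume_ball_le hn ENNReal.one_ne_top
  set s := α / (n : ℝ) with hs
  -- A ball of radius at most `R` that meets `ball x₀ 1` stays inside this one.
  set B := Metric.ball x₀ (2 * R + 1) with hB
  set F₁ := B.indicator F with hF₁
  set N := ∫⁻ y, F₁ y with hN
  have hNtop : N ≠ ∞ := by
    rw [hN, hF₁, lintegral_indicator Metric.isOpen_ball.measurableSet]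
    exact hball _ _
  set K := 2 * (C : ℝ≥0∞) * youngInv Ψ 1 with hK
  have hKtop : K ≠ ∞ := ENNReal.mul_ne_top (by simp [ENNReal.mul_eq_top])
    (by simpa using hΨ.youngInv_ne_top 1)
  let E : ℕ → Set (Rn n) := fun k => averageSuperlevel F₁ (2 ^ k)
  have hE : ∀ k, MeasurableSet (E k) := fun k => (isOpen_averageSuperlevel _ _).measurableSet
  have hpt : ∀ x ∈ Metric.ball x₀ 1, lfracMaximal α F x ≤
      K + N ^ s * (1 + ∑' k : ℕ, if x ∈ E k then ((2 : ℝ≥0∞) ^ (k + 1)) ^ (1 - s) else 0) := by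
    intro x hx
    refine iSup_le fun c => iSup_le fun r => iSup_le fun hxB => ?_
    have hr := Metric.pos_of_mem_ball hxB
    have hV0 : volume (Metric.ball c r) ≠ 0 := (Metric.measure_ball_pos volume _ hr).ne'
    have hV : volume (Metric.ball c r) ≠ ∞ := measure_ball_lt_top.ne
    rcases le_total 1 (volume (Metric.ball c r)) with h1 | h1
    · refine le_add_right ?_
      obtain ⟨b, hI, hb⟩ := hΦ.exists_average hball c hr
      have hb1 := (hb.trans (setLIntegral_le_lintegral _ _)).trans hF
      refine (InverseCondition.average_le hα.le hΦ hC hV0 hV hI hb1).trans ?_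
      rw [hK]
      gcongr
      refine youngInv_mono Ψ ?_
      calc Φ b = Φ b * 1 := (mul_one _).symm
        _ ≤ Φ b * volume (Metric.ball c r) := by gcongr
        _ ≤ 1 := hb1
    · refine le_add_left ?_
      have hrR := hR c r h1
      have hsub : Metric.ball c r ⊆ B := by
        intro y hy
        rw [hB, Metric.mem_ball]
        rw [Metric.mem_ball] at hx hxB hy
        have := dist_triangle y c x₀
        have := dist_triangle c x x₀
        rw [dist_comm c x] at this
        linarith
      have hI : ∫⁻ y in Metric.ball c r, F y = ∫⁻ y in Metric.ball c r, F₁ y :=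
        setLIntegral_congr_fun Metric.isOpen_ball.measurableSet fun y hy => by
          simp [hF₁, indicator_of_mem (hsub hy)]
      have hIN : ∫⁻ y in Metric.ball c r, F₁ y ≤ N := setLIntegral_le_lintegral _ _
      rw [hI, ENNReal.rpow_neg_one_add_mul_self hs0.le hs1.le, mul_comm]
      gcongr
      refine ENNReal.rpow_le_one_add_tsum (ENNReal.div_ne_top (ne_top_of_le_ne_top hNtop hIN) hV0)
        (by linarith) (fun k => x ∈ E k) fun k hk => ⟨c, r, hxB, ?_⟩
      exact (ENNReal.le_div_iff_mul_le (Or.inl hV0) (Or.inl hV)).1 hk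
  -- The decay `2^(-k)` of the superlevel sets beats `2^(k(1-s))`, leaving the ratio `2^(-s) < 1`.
  have hterm : ∀ k : ℕ, ((2 : ℝ≥0∞) ^ (k + 1)) ^ (1 - s) * volume (E k) ≤
      2 ^ (1 - s) * (5 ^ n * N) * (2 ^ (-s)) ^ k := by
    intro k
    have h2 : (2 : ℝ≥0∞) ^ k ≠ 0 := by positivity
    have h2' : (2 : ℝ≥0∞) ^ k ≠ ∞ := by simp
    have hvol : volume (E k) ≤ (2 ^ k)⁻¹ * (5 ^ n * N) := by
      rw [← ENNReal.mul_le_iff_le_inv h2 h2']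
      exact mul_volume_averageSuperlevel_le hn _ _
    have e : ((2 : ℝ≥0∞) ^ (k + 1)) ^ (1 - s) * (2 ^ k)⁻¹ = 2 ^ (1 - s) * (2 ^ (-s)) ^ k := by
      simp only [← ENNReal.rpow_natCast, ← ENNReal.rpow_mul, ← ENNReal.rpow_neg]
      rw [← ENNReal.rpow_add _ _ two_ne_zero ENNReal.ofNat_ne_top,
        ← ENNReal.rpow_add _ _ two_ne_zero ENNReal.ofNat_ne_top]
      congr 1; push_cast; ring
    calc _ ≤ ((2 : ℝ≥0∞) ^ (k + 1)) ^ (1 - s) * ((2 ^ k)⁻¹ * (5 ^ n * N)) := by gcongr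
      _ = _ := by rw [← mul_assoc, e]; ring
  have hsum : ∑' k : ℕ, ((2 : ℝ≥0∞) ^ (k + 1)) ^ (1 - s) * volume (E k) ≠ ∞ := by
    refine ne_top_of_le_ne_top ?_ (ENNReal.tsum_le_tsum hterm)
    rw [ENNReal.tsum_mul_left, ENNReal.tsum_geometric]
    have hlt : (2 : ℝ≥0∞) ^ (-s) < 1 :=
      ENNReal.rpow_lt_one_of_one_lt_of_neg (by norm_num) (by linarith)
    refine ENNReal.mul_ne_top (ENNReal.mul_ne_top ?_ (ENNReal.mul_ne_top (by simp) hNtop)) ?_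
    · exact ENNReal.rpow_ne_top_of_nonneg (by linarith) (by simp)
    · exact ENNReal.inv_ne_top.2 (tsub_pos_of_lt hlt).ne'
  have hmeas : ∀ k : ℕ, Measurable fun x : Rn n =>
      if x ∈ E k then ((2 : ℝ≥0∞) ^ (k + 1)) ^ (1 - s) else 0 := fun k =>
    Measurable.ite (hE k) measurable_const measurable_const
  have hint : ∀ k : ℕ, ∫⁻ x in Metric.ball x₀ 1,
      (if x ∈ E k then ((2 : ℝ≥0∞) ^ (k + 1)) ^ (1 - s) else 0) ≤
        ((2 : ℝ≥0∞) ^ (k + 1)) ^ (1 - s) * volume (E k) := fun k =>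
    (setLIntegral_le_lintegral _ _).trans (lintegral_indicator_const (hE k) _).le
  have hNs : N ^ s ≠ ∞ := ENNReal.rpow_ne_top_of_nonneg hs0.le hNtop
  have hU : volume (Metric.ball x₀ 1) ≠ ∞ := measure_ball_lt_top.ne
  refine ne_top_of_le_ne_top ?_ (setLIntegral_mono' Metric.isOpen_ball.measurableSet hpt)
  rw [lintegral_add_left measurable_const, lintegral_const_mul' _ _ hNs,
    lintegral_add_left measurable_const, lintegral_tsum fun k => (hmeas k).aemeasurable,
    setLIntegral_const, setLIntegral_const]
  refine ENNReal.add_ne_top.2 ⟨ENNReal.mul_ne_top hKtop hU, ENNReal.mul_ne_top hNs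
    (ENNReal.add_ne_top.2 ⟨by simpa using hU, ?_⟩)⟩
  exact ne_top_of_le_ne_top hsum (ENNReal.tsum_le_tsum hint)

end

/-! ### Orlicz norms -/

theorem ENNReal.div_coe_mul (a : ℝ≥0∞) {x y : ℝ≥0} (hx : x ≠ 0) :
    a / ((x * y : ℝ≥0) : ℝ≥0∞) = a / x / y := by
  rw [ENNReal.coe_mul, div_eq_mul_inv, ENNReal.mul_inv (Or.inl (by exact_mod_cast hx))
    (Or.inl ENNReal.coe_ne_top), ← mul_assoc]
  rfl

theorem IsYoung.youngExt_div_le {Φ : ℝ≥0 → ℝ≥0∞} (h : IsYoung Φ) {K : ℝ≥0} (hK : 1 ≤ K)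
    (u : ℝ≥0∞) : youngExt Φ (u / K) ≤ (K : ℝ≥0∞)⁻¹ * youngExt Φ u := by
  have hK0 : K ≠ 0 := (zero_lt_one.trans_le hK).ne'
  have := h.youngExt_mul_le (inv_le_one_of_one_le₀ hK) u
  rwa [ENNReal.coe_inv hK0, mul_comm, ← div_eq_mul_inv] at this

/-- A constant factor in an estimate for a Young function can be absorbed. -/
theorem IsYoung.lintegral_div_le_one {Φ : ℝ≥0 → ℝ≥0∞} (h : IsYoung Φ) {X : Type*}
    [MeasurableSpace X] {μ : Measure X} {G : X → ℝ≥0∞} {K : ℝ≥0} (hK : 1 ≤ K)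
    (hG : ∫⁻ x, youngExt Φ (G x) ∂μ ≤ K) : ∫⁻ x, youngExt Φ (G x / K) ∂μ ≤ 1 := by
  have hK0 : (K : ℝ≥0∞) ≠ 0 := by exact_mod_cast (zero_lt_one.trans_le hK).ne'
  calc ∫⁻ x, youngExt Φ (G x / K) ∂μ ≤ ∫⁻ x, (K : ℝ≥0∞)⁻¹ * youngExt Φ (G x) ∂μ :=
        lintegral_mono fun x => h.youngExt_div_le hK _
    _ = (K : ℝ≥0∞)⁻¹ * ∫⁻ x, youngExt Φ (G x) ∂μ :=
        lintegral_const_mul' _ _ (ENNReal.inv_ne_top.2 hK0)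
    _ ≤ (K : ℝ≥0∞)⁻¹ * K := by gcongr
    _ = 1 := ENNReal.inv_mul_cancel hK0 ENNReal.coe_ne_top

section

variable {n : ℕ} {α : ℝ} {Φ Ψ : ℝ≥0 → ℝ≥0∞}

/-- By convexity, dividing the argument by a bound `K ≥ 1` of the modular brings the modular down to
at most 1. -/
theorem MemOrlicz.exists_lintegral_le_one (hΦ : IsYoung Φ) {f : Rn n → ℝ} (hf : MemOrlicz Φ f) :
    ∃ l : ℝ≥0, 0 < l ∧ ∫⁻ x, youngExt Φ (‖f x‖ₑ / l) ≤ 1 := by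
  obtain ⟨-, k, hk, hJ⟩ := hf
  set K : ℝ≥0 := max 1 (∫⁻ x, youngExt Φ ((k : ℝ≥0∞) * ‖f x‖ₑ)).toNNReal with hKdef
  have hK : 1 ≤ K := le_max_left _ _
  have hle : ∫⁻ x, youngExt Φ ((k : ℝ≥0∞) * ‖f x‖ₑ) ≤ K := by
    rw [← ENNReal.coe_toNNReal hJ.ne]
    exact_mod_cast le_max_right _ _
  refine ⟨k⁻¹ * K, mul_pos (inv_pos.2 hk) (zero_lt_one.trans_le hK), ?_⟩
  have := hΦ.lintegral_div_le_one hK hle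
  simp only [ENNReal.div_coe_mul _ (inv_ne_zero hk.ne')]
  simpa [ENNReal.coe_inv hk.ne', div_eq_mul_inv, mul_comm, mul_left_comm] using this

theorem MemOrlicz.orliczNorm_lt_top (hΦ : IsYoung Φ) {f : Rn n → ℝ} (hf : MemOrlicz Φ f) :
    orliczNorm Φ f < ∞ := by
  obtain ⟨l, hl⟩ := hf.exists_lintegral_le_one hΦ
  exact (iInf₂_le l hl).trans_lt ENNReal.coe_lt_top

theorem le_mul_orliczNorm {f : Rn n → ℝ} {K : ℝ≥0} (hK : K ≠ 0) {a : ℝ≥0∞}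
    (h : ∀ l : ℝ≥0, 0 < l → ∫⁻ x, youngExt Φ (‖f x‖ₑ / l) ≤ 1 → a ≤ ((K * l : ℝ≥0) : ℝ≥0∞)) :
    a ≤ K * orliczNorm Φ f := by
  have hK' : (K : ℝ≥0∞) ≠ 0 := by exact_mod_cast hK
  have : a / K ≤ orliczNorm Φ f := le_iInf₂ fun l hl => by
    refine ENNReal.div_le_of_le_mul' ?_
    exact_mod_cast h l hl.1 hl.2
  rw [mul_comm]
  exact (ENNReal.div_le_iff_le_mul (Or.inl hK') (Or.inl ENNReal.coe_ne_top)).1 this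

/-- Chebyshev's inequality for `Ψ(g/l)` at height `Ψ t`. -/
theorem weakOrliczNorm_le_orliczNorm (hΨ : IsYoung Ψ) {g : Rn n → ℝ≥0∞} (hg : Measurable g) :
    weakOrliczNorm Ψ g ≤ orliczNorm Ψ g := by
  refine le_iInf₂ fun l hl => iInf₂_le l ⟨hl.1, iSup₂_le fun t _ => hl.2.trans' ?_⟩
  have hm : AEMeasurable fun x => youngExt Ψ (‖g x‖ₑ / l) :=
    (hΨ.youngExt_mono.measurable.comp (hg.enorm.div_const _)).aemeasurable
  refine le_trans ?_ (mul_meas_ge_le_lintegral₀ hm (Ψ t))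
  gcongr with x
  intro hx
  have := hΨ.youngExt_mono hx.le
  simpa [youngExt] using this

theorem lintegral_ball_div_ne_top {f : Rn n → ℝ} (hf : LocallyIntegrable f) {l : ℝ≥0} (hl : l ≠ 0)
    (c : Rn n) (r : ℝ) : ∫⁻ y in Metric.ball c r, ‖f y‖ₑ / l ≠ ∞ := by
  have hl' : (l : ℝ≥0∞)⁻¹ ≠ ∞ := ENNReal.inv_ne_top.2 (by exact_mod_cast hl)
  simp only [div_eq_mul_inv]
  rw [lintegral_mul_const' _ _ hl']
  exact ENNReal.mul_ne_top ((hf.integrableOn_isCompact (isCompact_closedBall c r)).mono_set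
    Metric.ball_subset_closedBall).2.ne hl'

theorem measurable_fracMaximal (α : ℝ) (f : Rn n → ℝ) : Measurable (fracMaximal α f) :=
  measurable_lfracMaximal α fun y => ‖f y‖ₑ

theorem InverseCondition.locallyIntegrable_fracMaximal (h : InverseCondition n α Φ Ψ)
    (hα : 0 < α) (hαn : α < n) (hΦ : IsClassY Φ) (hΨ : IsYoung Ψ) {f : Rn n → ℝ}
    (hf : MemOrlicz Φ f) : LocallyIntegrable (fracMaximal α f) := by
  have hn : n ≠ 0 := by rintro rfl; simp at hαn; linarith
  obtain ⟨C, -, hC⟩ := h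
  obtain ⟨l, hl, hF⟩ := hf.exists_lintegral_le_one hΦ.1
  have hl0 : (l : ℝ≥0∞) ≠ 0 := by exact_mod_cast hl.ne'
  intro x₀
  refine ⟨Metric.ball x₀ 1, Metric.ball_mem_nhds x₀ one_pos,
    (measurable_fracMaximal α f).aestronglyMeasurable, ?_⟩
  have := setLIntegral_lfracMaximal_ne_top hn hα hαn hΦ hΨ hC
    (lintegral_ball_div_ne_top hf.1 hl.ne') hF x₀
  simp only [← fracMaximal_div α f hl.ne'] at this
  simp only [div_eq_mul_inv] at this
  rw [lintegral_mul_const' _ _ (ENNReal.inv_ne_top.2 hl0)] at this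
  have hlt := ENNReal.lt_top_of_mul_ne_top_left this (ENNReal.inv_ne_zero.2 ENNReal.coe_ne_top)
  simpa [HasFiniteIntegral] using hlt

/-! ### Sufficiency -/

theorem InverseCondition.fracMaximalWeakBounded (h : InverseCondition n α Φ Ψ)
    (hα : 0 < α) (hαn : α < n) (hΦ : IsClassY Φ) (hΨ : IsYoung Ψ) :
    FracMaximalWeakBounded n α Φ Ψ := by
  have hn : n ≠ 0 := by rintro rfl; simp at hαn; linarith
  have hloc := fun f hf => h.locallyIntegrable_fracMaximal hα hαn hΦ hΨ (f := f) hf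
  obtain ⟨C, hC0, hC⟩ := h
  have h5 : (5 ^ n : ℝ≥0) ≠ 0 := by positivity
  have hKpos : (2 * C * 5 ^ n : ℝ≥0) ≠ 0 := by positivity
  have hnorm : ∀ f : Rn n → ℝ, MemOrlicz Φ f →
      weakOrliczNorm Ψ (fracMaximal α f) ≤ (2 * C * 5 ^ n : ℝ≥0) * orliczNorm Φ f := by
    intro f hf
    refine le_mul_orliczNorm hKpos fun l hl hF => iInf₂_le _ ⟨by positivity, ?_⟩
    refine iSup₂_le fun t _ => ?_
    -- The Vitali constant `5^n` in the norm bound moves onto the level `t`, where convexity of `Ψ`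
    -- turns it into a factor `5^(-n)`.
    have hset : {x | (t : ℝ≥0∞) < ‖fracMaximal α f x‖ₑ / (2 * C * 5 ^ n * l : ℝ≥0)} ⊆
        {x | ((5 ^ n * t : ℝ≥0) : ℝ≥0∞) <
          lfracMaximal α (fun y => ‖f y‖ₑ / l) x / (2 * C : ℝ≥0)} := by
      intro x hx
      simp only [mem_ofPred_eq, enorm_eq_self] at hx ⊢
      rw [mul_comm _ l, ENNReal.div_coe_mul _ hl.ne', ENNReal.div_coe_mul _ (by positivity),
        fracMaximal_div _ _ hl.ne', ENNReal.lt_div_iff_mul_lt (Or.inl (by exact_mod_cast h5))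
        (Or.inl ENNReal.coe_ne_top)] at hx
      rwa [mul_comm, ENNReal.coe_mul]
    have hΨt : Ψ t ≤ ((5 ^ n : ℝ≥0) : ℝ≥0∞)⁻¹ * Ψ (5 ^ n * t) := by
      have := hΨ.map_mul_le (inv_le_one_of_one_le₀ (one_le_pow₀ (by norm_num : (1 : ℝ≥0) ≤ 5)))
        (5 ^ n * t) (c := (5 ^ n)⁻¹)
      rwa [inv_mul_cancel_left₀ h5, ENNReal.coe_inv h5] at this
    calc _ ≤ (((5 ^ n : ℝ≥0) : ℝ≥0∞)⁻¹ * Ψ (5 ^ n * t)) * volume {x | ((5 ^ n * t : ℝ≥0) : ℝ≥0∞) <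
          lfracMaximal α (fun y => ‖f y‖ₑ / l) x / (2 * C : ℝ≥0)} :=
          mul_le_mul' hΨt (measure_mono hset)
      _ ≤ ((5 ^ n : ℝ≥0) : ℝ≥0∞)⁻¹ * 5 ^ n := by
          rw [mul_assoc]
          gcongr
          exact weak_estimate hn hα.le hΦ hC hC0.ne' (lintegral_ball_div_ne_top hf.1 hl.ne') hF _
      _ = 1 := by
          push_cast
          exact ENNReal.inv_mul_cancel (by positivity) (by simp)
  refine ⟨2 * C * 5 ^ n, fun f hf => ⟨⟨hloc f hf, ?_⟩, hnorm f hf⟩⟩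
  exact (hnorm f hf).trans_lt (ENNReal.mul_lt_top ENNReal.coe_lt_top (hf.orliczNorm_lt_top hΦ.1))

theorem InverseCondition.fracMaximalBounded (h : InverseCondition n α Φ Ψ)
    (hα : 0 < α) (hαn : α < n) (hΦ : IsClassY Φ) (hΨ : IsYoung Ψ) (hΦ2 : Nabla2 Φ) :
    FracMaximalBounded n α Φ Ψ := by
  have hn : n ≠ 0 := by rintro rfl; simp at hαn; linarith
  have hloc := fun f hf => h.locallyIntegrable_fracMaximal hα hαn hΦ hΨ (f := f) hf
  obtain ⟨C, hC0, hC⟩ := h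
  obtain ⟨D, hD, hD2⟩ := hΦ2
  have hD0 : D ≠ 0 := (zero_lt_one.trans hD).ne'
  set K : ℝ≥0 := 5 ^ n * (2 * D) with hKdef
  have hK : 1 ≤ K := by
    have h5 : (1 : ℝ≥0) ≤ 5 ^ n := one_le_pow₀ (by norm_num)
    have h2 : (1 : ℝ≥0) ≤ 2 * D := one_le_mul_of_one_le_of_one_le (by norm_num) hD.le
    exact one_le_mul_of_one_le_of_one_le h5 h2
  have hKpos : 0 < K := zero_lt_one.trans_le hK
  have hDpos : 0 < D := pos_iff_ne_zero.2 hD0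
  -- The extra `D` comes from applying `strong_estimate` to `|f|/(lD)`: its right side then involves
  -- exactly `Φ(|f|/l)`.
  have key : ∀ f : Rn n → ℝ, MemOrlicz Φ f → ∀ l : ℝ≥0, 0 < l →
      ∫⁻ x, youngExt Φ (‖f x‖ₑ / l) ≤ 1 →
      ∫⁻ x, youngExt Ψ (‖fracMaximal α f x‖ₑ / (D * (2 * C) * K * l : ℝ≥0)) ≤ 1 := by
    intro f hf l hl hF
    have hlD : l * D ≠ 0 := mul_ne_zero hl.ne' hD0
    have hDF : ∀ x, (D : ℝ≥0∞) * (‖f x‖ₑ / (l * D : ℝ≥0)) = ‖f x‖ₑ / l := fun x => by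
      rw [ENNReal.div_coe_mul _ hl.ne',
        ENNReal.mul_div_cancel (by exact_mod_cast hD0) ENNReal.coe_ne_top]
    have hF' : ∫⁻ x, youngExt Φ (‖f x‖ₑ / (l * D : ℝ≥0)) ≤ 1 := by
      refine (lintegral_mono fun x => hΦ.1.youngExt_mono ?_).trans hF
      rw [← hDF x]
      exact le_mul_of_one_le_left' (by exact_mod_cast hD.le)
    have hmeas : AEMeasurable fun x => ‖f x‖ₑ / ((l * D : ℝ≥0) : ℝ≥0∞) :=
      hf.1.aestronglyMeasurable.enorm.div_const _
    have hs := strong_estimate hn hα.le hΦ hΨ hC hC0.ne' hmeas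
      (lintegral_ball_div_ne_top hf.1 hlD) hF' hD hD2
    simp only [hDF] at hs
    have hs' : ∫⁻ x, youngExt Ψ (lfracMaximal α (fun y => ‖f y‖ₑ / (l * D : ℝ≥0)) x /
        (2 * C : ℝ≥0)) ≤ K := by
      refine hs.trans ?_
      calc _ ≤ (5 : ℝ≥0∞) ^ n * (2 * D) * 1 := by gcongr
        _ = K := by rw [hKdef]; push_cast; ring
    refine (lintegral_congr fun x => ?_).trans_le (hΨ.lintegral_div_le_one hK hs')
    rw [← fracMaximal_div _ _ hlD, ← ENNReal.div_coe_mul _ hlD,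
      ← ENNReal.div_coe_mul _ (by positivity), enorm_eq_self]
    congr 3; ring
  have hCpos : D * (2 * C) * K ≠ 0 := by positivity
  refine ⟨D * (2 * C) * K, fun f hf => ⟨⟨hloc f hf, ?_⟩, ?_⟩⟩
  · obtain ⟨l, hl, hF⟩ := hf.exists_lintegral_le_one hΦ.1
    have hpos : 0 < D * (2 * C) * K * l := by positivity
    refine ⟨(D * (2 * C) * K * l)⁻¹, inv_pos.2 hpos, ?_⟩
    refine lt_of_le_of_lt ?_ ((key f hf l hl hF).trans_lt ENNReal.one_lt_top)
    simp only [ENNReal.coe_inv hpos.ne', mul_comm _ ‖fracMaximal α f _‖ₑ, ← div_eq_mul_inv, le_refl]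
  · exact le_mul_orliczNorm hCpos fun l hl hF => iInf₂_le _ ⟨by positivity, key f hf l hl hF⟩

/-! ### Necessity -/

theorem FracMaximalBounded.fracMaximalWeakBounded (hΦ : IsYoung Φ) (hΨ : IsYoung Ψ)
    (h : FracMaximalBounded n α Φ Ψ) : FracMaximalWeakBounded n α Φ Ψ := by
  obtain ⟨C, hC⟩ := h
  refine ⟨C, fun f hf => ?_⟩
  obtain ⟨hmem, hle⟩ := hC f hf
  have hle' := (weakOrliczNorm_le_orliczNorm hΨ (measurable_fracMaximal α f)).trans hle
  exact ⟨⟨hmem.1, hle'.trans_lt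
    (ENNReal.mul_lt_top ENNReal.coe_lt_top (hf.orliczNorm_lt_top hΦ))⟩, hle'⟩

theorem exists_volume_ball_eq (hn : n ≠ 0) {v : ℝ≥0} (hv : 0 < v) :
    ∃ ρ : ℝ, 0 < ρ ∧ volume (Metric.ball (0 : Rn n) ρ) = v := by
  have hV0 : volume (Metric.ball (0 : Rn n) 1) ≠ 0 :=
    (Metric.measure_ball_pos volume _ one_pos).ne'
  have hV : volume (Metric.ball (0 : Rn n) 1) ≠ ∞ := measure_ball_lt_top.ne
  obtain ⟨V, hVV⟩ : ∃ V : ℝ≥0, (V : ℝ≥0∞) = volume (Metric.ball (0 : Rn n) 1) :=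
    ⟨_, ENNReal.coe_toNNReal hV⟩
  have hVpos : 0 < V := pos_iff_ne_zero.2 (by rw [← hVV] at hV0; exact_mod_cast hV0)
  have hpos : 0 < v / V := div_pos hv hVpos
  have hρ : 0 < (v / V) ^ (1 / (n : ℝ)) := NNReal.rpow_pos hpos
  refine ⟨((v / V) ^ (1 / (n : ℝ)) : ℝ≥0), by exact_mod_cast hρ, ?_⟩
  rw [Measure.addHaar_ball_of_pos volume _ (by exact_mod_cast hρ), finrank_euclideanSpace_fin,
    ← hVV, ← NNReal.coe_pow, ENNReal.ofReal_coe_nnreal, ← NNReal.rpow_natCast, ← NNReal.rpow_mul,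
    one_div_mul_cancel (by exact_mod_cast hn), NNReal.rpow_one, ← ENNReal.coe_mul,
    div_mul_cancel₀ _ hVpos.ne']

theorem FracMaximalWeakBounded.inverseCondition (hn : n ≠ 0) (hΦ : IsYoung Φ) (hΨ : IsYoung Ψ)
    (h : FracMaximalWeakBounded n α Φ Ψ) : InverseCondition n α Φ Ψ := by
  obtain ⟨C, hC⟩ := h
  -- Replacing `C` by `C + 1` makes the norm bound strict, so the infimum yields an admissible `l <
  -- (C + 1)/J`.
  refine ⟨C + 1, by positivity, fun r hr => ?_⟩
  obtain ⟨ρ, hρ, hB⟩ := exists_volume_ball_eq hn (inv_pos.2 hr)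
  rw [ENNReal.coe_inv hr.ne'] at hB
  have hr0 : (r : ℝ≥0∞) ≠ 0 := by exact_mod_cast hr.ne'
  set B := Metric.ball (0 : Rn n) ρ
  have hBm : MeasurableSet B := Metric.isOpen_ball.measurableSet
  obtain ⟨J, hJ⟩ : ∃ J : ℝ≥0, (J : ℝ≥0∞) = youngInv Φ r :=
    ⟨_, ENNReal.coe_toNNReal (hΦ.youngInv_ne_top r)⟩
  have hΦJ : Φ J ≤ r := by
    have := hΦ.youngExt_le_of_forall_lt (u := J) (S := r) fun t ht =>
      le_of_lt_youngInv (hJ ▸ ht)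
    simpa [youngExt] using this
  have hJ0 : 0 < J := by
    have hev : ∀ᶠ t in 𝓝[>] (0 : ℝ≥0), Φ t < r ∧ 0 < t :=
      (hΦ.tendsto_zero.eventually (gt_mem_nhds (pos_iff_ne_zero.2 hr0))).and self_mem_nhdsWithin
    obtain ⟨δ, hδ, hδ0⟩ := hev.exists
    have : (δ : ℝ≥0∞) ≤ J := by
      rw [hJ]
      exact le_iInf₂ fun s hs => by exact_mod_cast (hΦ.monotone.reflect_lt (hδ.trans hs)).le
    exact hδ0.trans_le (by exact_mod_cast this)
  let f : Rn n → ℝ := B.indicator fun _ => 1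
  have hf_enorm : ∀ x, ‖f x‖ₑ = B.indicator (fun _ => 1) x := fun x => by
    by_cases hx : x ∈ B <;> simp [f, hx]
  have hint : ∫⁻ x, youngExt Φ ((J : ℝ≥0∞) * ‖f x‖ₑ) ≤ 1 := by
    have : ∀ x, youngExt Φ ((J : ℝ≥0∞) * ‖f x‖ₑ) = B.indicator (fun _ => Φ J) x := fun x => by
      by_cases hx : x ∈ B <;> simp [hf_enorm, hx, youngExt, hΦ.map_zero]
    simp only [this]
    rw [lintegral_indicator_const hBm, hB]
    calc Φ J * (r : ℝ≥0∞)⁻¹ ≤ r * (r : ℝ≥0∞)⁻¹ := by gcongr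
      _ = 1 := ENNReal.mul_inv_cancel hr0 ENNReal.coe_ne_top
  have hf : MemOrlicz Φ f := by
    refine ⟨Integrable.locallyIntegrable ?_, J, hJ0, hint.trans_lt ENNReal.one_lt_top⟩
    exact (integrable_indicator_iff hBm).2 (integrableOn_const (by rw [hB]; simp [hr.ne']))
  have hnorm : orliczNorm Φ f ≤ (J⁻¹ : ℝ≥0) := by
    refine iInf₂_le _ ⟨inv_pos.2 hJ0, ?_⟩
    simpa [ENNReal.coe_inv hJ0.ne', div_eq_mul_inv, mul_comm] using hint
  have hlt : weakOrliczNorm Ψ (fracMaximal α f) < ((C + 1) * J⁻¹ : ℝ≥0) := by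
    calc _ ≤ C * orliczNorm Φ f := (hC f hf).2
      _ ≤ C * (J⁻¹ : ℝ≥0) := by gcongr
      _ = (C * J⁻¹ : ℝ≥0) := (ENNReal.coe_mul _ _).symm
      _ < _ := by
        have hlt : C < C + 1 := lt_add_one C
        have hJ' : 0 < J⁻¹ := inv_pos.2 hJ0
        exact_mod_cast mul_lt_mul_of_pos_right hlt hJ'
  simp only [weakOrliczNorm, iInf_lt_iff] at hlt
  obtain ⟨l, ⟨hl, hsup⟩, hlC⟩ := hlt
  have hmax : ∀ x ∈ B, (r : ℝ≥0∞) ^ (-(α / (n : ℝ))) ≤ fracMaximal α f x := by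
    intro x hx
    have hval : volume B ^ (-1 + α / (n : ℝ)) * ∫⁻ y in B, ‖f y‖ₑ =
        (r : ℝ≥0∞) ^ (-(α / (n : ℝ))) := by
      have h1 : ∫⁻ y in B, ‖f y‖ₑ = volume B := by
        rw [setLIntegral_congr_fun hBm (g := fun _ => 1) fun y hy => by simp [hf_enorm, hy]]
        simp
      rw [h1, hB, ENNReal.inv_rpow, ← ENNReal.rpow_neg]
      rw [← ENNReal.rpow_neg_one (r : ℝ≥0∞), ← ENNReal.rpow_add _ _ hr0 ENNReal.coe_ne_top]
      congr 1; ring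
    rw [← hval]
    exact le_iSup_of_le 0 (le_iSup_of_le ρ (le_iSup_of_le hx le_rfl))
  rw [← hJ, mul_comm]
  have hC1 : ((C + 1 : ℝ≥0) : ℝ≥0∞) ≠ 0 := by exact_mod_cast (by positivity : C + 1 ≠ 0)
  rw [mul_comm _ (youngInv Ψ r), ← ENNReal.div_le_iff_le_mul (Or.inl hC1)
    (Or.inl ENNReal.coe_ne_top)]
  -- If a `t` with `Ψ t > r` violated the bound, then `t * l < r^(-α/n) ≤ M_α f` on `B`, so `Ψ t *
  -- |B| ≤ 1`, that is `Ψ t ≤ r`.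
  refine le_iInf₂ fun t ht => ENNReal.div_le_of_le_mul ?_
  by_contra! hcon
  have ht0 : 0 < t := by
    rw [pos_iff_ne_zero]
    rintro rfl
    simp [hΨ.map_zero] at ht
  have hJ0' : (J : ℝ≥0∞) ≠ 0 := by exact_mod_cast hJ0.ne'
  have hlt' : (t : ℝ≥0∞) * l < (r : ℝ≥0∞) ^ (-(α / (n : ℝ))) := by
    calc (t : ℝ≥0∞) * l ≤ t * ((C + 1) * J⁻¹ : ℝ≥0) := by gcongr
      _ = t * (C + 1 : ℝ≥0) / J := by
        rw [ENNReal.coe_mul, ENNReal.coe_inv hJ0.ne', ← mul_assoc, div_eq_mul_inv]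
      _ < _ := ENNReal.div_lt_of_lt_mul' hcon
  have hsub : B ⊆ {x | (t : ℝ≥0∞) < ‖fracMaximal α f x‖ₑ / l} := fun x hx => by
    rw [mem_ofPred_eq, enorm_eq_self, ENNReal.lt_div_iff_mul_lt (Or.inl (by exact_mod_cast hl.ne'))
      (Or.inl ENNReal.coe_ne_top)]
    exact hlt'.trans_le (hmax x hx)
  have hle : Ψ t * volume B ≤ 1 := by
    refine le_trans ?_ ((le_iSup₂ (f := fun (t : ℝ≥0) (_ : 0 < t) =>
      Ψ t * volume {x : Rn n | (t : ℝ≥0∞) < ‖fracMaximal α f x‖ₑ / (l : ℝ≥0∞)}) t ht0).trans hsup)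
    gcongr
  rw [hB, ← div_eq_mul_inv, ENNReal.div_le_iff_le_mul (Or.inl hr0) (Or.inl ENNReal.coe_ne_top),
    one_mul] at hle
  exact ht.not_ge hle

end

theorem mainTheorem1 (n : ℕ) (α : ℝ) (hα : 0 < α) (hαn : α < (n : ℝ))
    (Φ Ψ : ℝ≥0 → ℝ≥0∞) (hΦ : IsClassY Φ) (hΨ : IsYoung Ψ) :
    (InverseCondition n α Φ Ψ ↔ FracMaximalWeakBounded n α Φ Ψ) ∧
    (Nabla2 Φ → (InverseCondition n α Φ Ψ ↔ FracMaximalBounded n α Φ Ψ)) := by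
  have hn : n ≠ 0 := by rintro rfl; simp at hαn; linarith
  exact ⟨⟨fun h => h.fracMaximalWeakBounded hα hαn hΦ hΨ,
      fun h => h.inverseCondition hn hΦ.1 hΨ⟩,
    fun hΦ2 => ⟨fun h => h.fracMaximalBounded hα hαn hΦ hΨ hΦ2,
      fun h => (h.fracMaximalWeakBounded hΦ.1 hΨ).inverseCondition hn hΦ.1 hΨ⟩⟩
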